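/- Let $d\ge 1$ and let $f\in\mathbb{R}[x,y,z]$ be homogeneous of degree $d$. Write $\mathcal V_{\mathbb C}(f)\subset\mathbb P^2(\mathbb C)$ for its zero set, $I_P(f,g)$ for the intersection multiplicity at $P$ (with $I_P(f,g)=\infty$ if $f,g$ have a common component through $P$), and, for forms $f,g$ without common factor, $f.g=\sum_P I_P(f,g)\,P$ for the intersection divisor. A divisor $D=\sum_P n_P P$ on $\mathcal V_{\mathbb C}(f)$ has degree $\sum_P n_P$ and conjugate $\overline D=\sum_P n_P\overline P$; we write $f.g\ge D$ if $I_P(f,g)\ge n_P$ for all $P$. The divisor $D$ is a *real-contact divisor* of $\mathcal V_{\mathbb C}(f)$ if $f.g=D+\overline D$ for some form $g\in\mathbb R[x,y,z]$. Given a real-contact divisor $D$ of degree $d(d-1)/2$, let $A_D=(a_{jk})$ denote any $d\times d$ matrix of forms of degree $d-1$ in $\mathbb C[x,y,z]$ obtained as follows: $a_{11}$ is real with $f.a_{11}=D+\overline D$; $a_{11},\dots,a_{1d}$ are linearly independent over $\mathbb C$ and $f.a_{1k}\ge D$ for all $k$; for $2\le j\le k\le d$, $a_{jk}$ satisfies $\overline{a_{1j}}\,a_{1k}=p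 f+a_{jk}a_{11}$ for some $p\in\mathbb C[x,y,z]$, with $a_{jj}$ real; and $a_{kj}=\overline{a_{jk}}$ for $j<k$. (Bars conjugate coefficients. Such a matrix is not assumed to be unique. No smoothness of $\mathcal V_{\mathbb C}(f)$ is assumed.) Put $M_D=f^{-(d-2)}A_D^{\mathrm{adj}}$, a matrix over $\mathbb C(x,y,z)$, and $\mathcal C_D=\{\lambda^T A_D\overline\lambda : \lambda\in\mathbb C^d\setminus\{0\}\}$. **Proposition.** Suppose there is a real line $\mathcal V_{\mathbb C}(\ell)$, $\ell\in\mathbb R[x,y,z]$ a nonzero linear form, such that $\mathcal V_{\mathbb C}(\ell)\cap\mathcal V_{\mathbb C}(f)$ consists of exactly $d$ distinct points, all of them real. If $D$ is a real-contact divisor of $\mathcal V_{\mathbb C}(f)$ of degree $d(d-1)/2$, $A_D$ is any matrix as above, and $\det(M_D)\equiv 0$, then there exists $g\in\mathcal C_D$ with $\ell^2\mid g$. -/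

import Mathlib

namespace RealContact

noncomputable section

/-- The complex projective plane. -/
abbrev P2 : Type := Projectivization ℂ (Fin 3 → ℂ)

/-- The polynomial ring `ℂ[x, y, z]`. -/
abbrev Poly : Type := MvPolynomial (Fin 3) ℂ

/-- A real polynomial, regarded as a complex one. -/
def toComplex (f : MvPolynomial (Fin 3) ℝ) : Poly :=
  MvPolynomial.map Complex.ofRealHom f

/-- Complex conjugation of the coefficients of a polynomial. -/
def conjPoly (g : Poly) : Poly :=
  MvPolynomial.map (starRingEnd ℂ) g

/-- Complex conjugation `[a : b : c] ↦ [ā : b̄ : c̄]` on the projective plane. Its fixed points are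
the real points. -/
def conjPoint : P2 → P2 :=
  Projectivization.map
    ((starLinearEquiv ℂ : (Fin 3 → ℂ) ≃ₗ⋆[ℂ] (Fin 3 → ℂ)) : (Fin 3 → ℂ) →ₗ⋆[ℂ] (Fin 3 → ℂ))
    (starLinearEquiv ℂ : (Fin 3 → ℂ) ≃ₗ⋆[ℂ] (Fin 3 → ℂ)).injective

/-- The projective zero set in the complex plane of a form `f`. -/
def zeroSet (f : Poly) : Set P2 :=
  {P | MvPolynomial.eval P.rep f = 0}

/-- The homogeneous prime ideal of a point `P = [v]`: the polynomials `g` such that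
`g (t v)` is the zero polynomial in `t`. -/
def pointIdeal (P : P2) : Ideal Poly :=
  RingHom.ker (MvPolynomial.aeval (fun i => Polynomial.C (P.rep i) * Polynomial.X) :
    Poly →ₐ[ℂ] Polynomial ℂ)

instance pointIdeal_isPrime (P : P2) : (pointIdeal P).IsPrime :=
  RingHom.ker_isPrime _

/-- The intersection multiplicity `I_P(f, g)` of two plane projective curves: with `S = ℂ[x, y, z]`
and `p` the homogeneous prime of `P`, the length of `S_p / (f, g)` as an `S_p`-module. It equals the
length of the quotient of the local ring of the plane at `P` by local equations of `f` and `g`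
(it is `0` off the intersection, and `⊤` on a common component). -/
def interMult (P : P2) (f g : Poly) : ℕ∞ :=
  Module.length (Localization.AtPrime (pointIdeal P))
    (Localization.AtPrime (pointIdeal P) ⧸
      Ideal.span {algebraMap Poly (Localization.AtPrime (pointIdeal P)) f,
        algebraMap Poly (Localization.AtPrime (pointIdeal P)) g})

/-- `Div(f)`: the free abelian group on the complex points of the curve of `f`, as the group of
finitely supported integer valued functions on the plane whose support lies on the curve. -/
def Div (f : Poly) : Submodule ℤ (P2 →₀ ℤ) :=
  Finsupp.supported ℤ ℤ (zeroSet f)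

/-- The degree `∑ nᵢ` of a divisor `∑ nᵢ Pᵢ`. -/
def divDeg (D : P2 →₀ ℤ) : ℤ :=
  D.sum fun _ n => n

/-- The conjugate divisor `∑ nᵢ P̄ᵢ` of `∑ nᵢ Pᵢ`. -/
def conjDiv (D : P2 →₀ ℤ) : P2 →₀ ℤ :=
  D.mapDomain conjPoint

/-- `f.g = E`: the forms `f`, `g` share no factor, and `E` is their intersection divisor
`∑ I_P(f, g) P`. -/
def IsInterDiv (f g : Poly) (E : P2 →₀ ℤ) : Prop :=
  IsRelPrime f g ∧ E ∈ Div f ∧ ∀ P : P2, ∃ n : ℕ, interMult P f g = n ∧ E P = n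

/-- `f.g ≥ D`, that is, `n_P ≤ I_P(f, g)` for all `P`, where `D = ∑ n_P P`. -/
def InterDivGe (f g : Poly) (D : P2 →₀ ℤ) : Prop :=
  ∀ P : P2, ∀ n : ℕ, (n : ℤ) ≤ D P → (n : ℕ∞) ≤ interMult P f g

/-- `D` is a real-contact divisor of the curve of the real form `f`: there is a real form `g` with
`f.g = D + D̄`. -/
def IsRealContactDivisor (f : MvPolynomial (Fin 3) ℝ) (D : P2 →₀ ℤ) : Prop :=
  D ∈ Div (toComplex f) ∧
    ∃ (e : ℕ) (g : MvPolynomial (Fin 3) ℝ), g.IsHomogeneous e ∧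
      IsInterDiv (toComplex f) (toComplex g) (D + conjDiv D)

/-- `A` is one of the matrices `A_D` obtained by the (Hermitian) Dixon construction from the real
form `f` of degree `d` and the real-contact divisor `D`. Index `0` is the first row or column. -/
structure IsDixonMatrix {d : ℕ} [NeZero d] (f : MvPolynomial (Fin 3) ℝ) (D : P2 →₀ ℤ)
    (A : Matrix (Fin d) (Fin d) Poly) : Prop where
  /-- All entries are forms of degree `d - 1`. -/
  homogeneous : ∀ j k, (A j k).IsHomogeneous (d - 1)
  /-- `A` is Hermitian; in particular its diagonal entries are real. -/
  hermitian : ∀ j k, A k j = conjPoly (A j k)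
  /-- `f.a₁₁ = D + D̄`. -/
  corner : IsInterDiv (toComplex f) (A 0 0) (D + conjDiv D)
  /-- The first row consists of forms `g` with `f.g ≥ D` ... -/
  row_ge : ∀ k, InterDivGe (toComplex f) (A 0 k) D
  /-- ... that are linearly independent over `ℂ`. -/
  row_linearIndependent : LinearIndependent ℂ (fun k => A 0 k)
  /-- For `2 ≤ j ≤ k ≤ d`, the entry `a_jk` is some `q` with `conj(a_1j) a_1k = p f + q a_11`. -/
  entry : ∀ j k, j ≠ 0 → j ≤ k →
    ∃ p : Poly, conjPoly (A 0 j) * A 0 k = p * toComplex f + A j k * A 0 0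

/-- The matrix `M_D = (1 / f ^ (d - 2)) A_D^adj`, with entries in the field of rational
functions `ℂ(x, y, z)`. -/
def dixonRep {d : ℕ} (f : MvPolynomial (Fin 3) ℝ) (A : Matrix (Fin d) (Fin d) Poly) :
    Matrix (Fin d) (Fin d) (FractionRing Poly) :=
  (1 / algebraMap Poly (FractionRing Poly) (toComplex f) ^ ((d : ℤ) - 2)) •
    A.adjugate.map (algebraMap Poly (FractionRing Poly))

/-- The system of curves `{λᵀ A λ̄ | λ ∈ ℂ^d, λ ≠ 0}`. -/
def curveSystem {d : ℕ} (A : Matrix (Fin d) (Fin d) Poly) : Set Poly :=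
  {g | ∃ v : Fin d → ℂ, v ≠ 0 ∧
    g = ∑ j, ∑ k, MvPolynomial.C (v j) * A j k * MvPolynomial.C (starRingEnd ℂ (v k))}

end

end RealContact

/-! Write ⟨v,w⟩ = vᵀ A w̄ (`sesq`), ℓ for the line and Z for its d points on f. The Dixon relations
make f divide every 2×2 minor of A (`IsDixonMatrix.dvd_minor`), so A has rank at most one at each
point of Z. A form of degree d-1 that vanishes on Z is divisible by ℓ (`lineForm_dvd_of_card`).

The aim is some v ≠ 0 such that ℓ divides the whole row ⟨v,·⟩. Then ⟨v,v⟩ = ℓq with deg q = d-2, and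
it remains to make q vanish at d-1 points of Z. At a point where A ≠ 0 this is automatic: cancel one
ℓ in a minor (`eval_quotient_eq_zero`).

If A vanishes nowhere on Z, singularity of A supplies v (`exists_lineForm_dvd_sesq`). If A vanishes
at some P₀ in Z, a dimension count suffices: impose one linear condition on v at each of the other
d-1 points. Where A ≠ 0 the condition kills the row; where A = 0 the row vanishes already, and the
condition kills q instead (`exists_functional_quotient`). -/

namespace RealContact

open MvPolynomial

/-! ### Linear forms, divisibility and points on a line. -/

/-- The linear form with coefficient vector `c`. -/
noncomputable def lineForm (c : Fin 3 → ℂ) : Poly := ∑ i, C (c i) * X i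

theorem eval_lineForm (c v : Fin 3 → ℂ) : eval v (lineForm c) = ∑ i, c i * v i := by
  simp [lineForm]

theorem lineForm_isHomogeneous (c : Fin 3 → ℂ) : (lineForm c).IsHomogeneous 1 :=
  IsHomogeneous.sum _ _ _ fun i _ => isHomogeneous_C_mul_X (c i) i

theorem pderiv_lineForm (c : Fin 3 → ℂ) (k : Fin 3) : pderiv k (lineForm c) = C (c k) := by
  classical
  simp [lineForm, pderiv_X, Pi.single_apply]

/-- Every form of degree one is a `lineForm`. -/
theorem exists_eq_lineForm {l : Poly} (hl : l.IsHomogeneous 1) :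
    ∃ c, l = lineForm c := by
  have h : l ∈ homogeneousSubmodule (Fin 3) ℂ 1 := hl
  rw [homogeneousSubmodule_one_eq_span_X, Submodule.mem_span_range_iff_exists_fun] at h
  obtain ⟨c, rfl⟩ := h
  exact ⟨c, by simp [lineForm, smul_eq_C_mul]⟩

/-- Elimination of the variable `X k` by means of the equation `lineForm c = 0`. -/
noncomputable def elim (c : Fin 3 → ℂ) (k : Fin 3) : Poly →ₐ[ℂ] Poly :=
  aeval fun i => if i = k then X k - C (c k)⁻¹ * lineForm c else X i

/-- Modulo the linear form the substitution fixes every variable. The case `c k = 0` is harmless,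
since the inverse is then 0. -/
theorem lineForm_dvd_sub_elim (c : Fin 3 → ℂ) (k : Fin 3) (g : Poly) :
    lineForm c ∣ g - elim c k g := by
  have h : (Ideal.Quotient.mkₐ ℂ (Ideal.span {lineForm c})).comp (elim c k) =
      Ideal.Quotient.mkₐ ℂ (Ideal.span {lineForm c}) := by
    ext i
    simp only [AlgHom.comp_apply, elim, aeval_X, Ideal.Quotient.mkₐ_eq_mk]
    split_ifs with hi
    · subst hi
      rw [eq_comm, Ideal.Quotient.mk_eq_mk_iff_sub_mem, Ideal.mem_span_singleton]
      exact ⟨C (c i)⁻¹, by ring⟩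
    · rfl
  have h' := congrArg (fun φ => φ g) h
  simp only [AlgHom.comp_apply, Ideal.Quotient.mkₐ_eq_mk] at h'
  rw [eq_comm, Ideal.Quotient.mk_eq_mk_iff_sub_mem, Ideal.mem_span_singleton] at h'
  exact h'

theorem elim_lineForm {c : Fin 3 → ℂ} {k : Fin 3} (hk : c k ≠ 0) :
    elim c k (lineForm c) = 0 := by
  have h : elim c k (lineForm c) = lineForm c - C (c k) * C (c k)⁻¹ * lineForm c := by
    conv_lhs => rw [lineForm]
    simp only [map_sum, map_mul, elim, aeval_X, algHom_C, algebraMap_eq]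
    have : ∀ i, C (c i) * (if i = k then X k - C (c k)⁻¹ * lineForm c else X i : Poly) =
        C (c i) * X i - if i = k then C (c k) * C (c k)⁻¹ * lineForm c else 0 := by
      intro i
      split_ifs with hi
      · subst hi; ring
      · ring
    simp only [this, Finset.sum_sub_distrib, Finset.sum_ite_eq', Finset.mem_univ, if_true]
    rfl
  rw [h, ← C_mul, mul_inv_cancel₀ hk]
  simp

theorem lineForm_dvd_iff_elim {c : Fin 3 → ℂ} {k : Fin 3} (hk : c k ≠ 0) (g : Poly) :
    lineForm c ∣ g ↔ elim c k g = 0 := by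
  constructor
  · rintro ⟨h, rfl⟩
    rw [map_mul, elim_lineForm hk, zero_mul]
  · intro h
    simpa [h] using lineForm_dvd_sub_elim c k g

theorem lineForm_dvd_mul {c : Fin 3 → ℂ} (hc : c ≠ 0) {g h : Poly}
    (hgh : lineForm c ∣ g * h) : lineForm c ∣ g ∨ lineForm c ∣ h := by
  obtain ⟨k, hk⟩ := Function.ne_iff.1 hc
  simp only [Pi.zero_apply] at hk
  rw [lineForm_dvd_iff_elim hk] at *
  rw [lineForm_dvd_iff_elim hk]
  simpa using hgh

theorem lineForm_ne_zero {c : Fin 3 → ℂ} (hc : c ≠ 0) : lineForm c ≠ 0 := by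
  obtain ⟨k, hk⟩ := Function.ne_iff.1 hc
  intro h
  have := pderiv_lineForm c k
  rw [h, map_zero, eq_comm, C_eq_zero] at this
  exact hk this

/-- A polynomial that vanishes on the plane `lineForm c = 0` is divisible by `lineForm c`. -/
theorem lineForm_dvd_of_eval {c : Fin 3 → ℂ} (hc : c ≠ 0) {g : Poly}
    (hg : ∀ v, ∑ i, c i * v i = 0 → eval v g = 0) : lineForm c ∣ g := by
  obtain ⟨k, hk⟩ := Function.ne_iff.1 hc
  simp only [Pi.zero_apply] at hk
  rw [lineForm_dvd_iff_elim hk]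
  refine MvPolynomial.funext fun v => ?_
  have key : ∀ h : Poly, eval v (elim c k h) = eval (fun i => eval v (elim c k (X i))) h := by
    intro h
    have : ((aeval v : Poly →ₐ[ℂ] ℂ).comp (elim c k)) =
        (aeval fun i => eval v (elim c k (X i)) : Poly →ₐ[ℂ] ℂ) := by
      ext i
      simp [aeval_eq_eval]
    simpa [aeval_eq_eval] using congrArg (fun φ => φ h) this
  rw [key, hg, map_zero]
  rw [← eval_lineForm, ← key, elim_lineForm hk, map_zero]

theorem eval_smul_of_isHomogeneous {g : Poly} {e : ℕ} (hg : g.IsHomogeneous e) (s : ℂ)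
    (v : Fin 3 → ℂ) : eval (s • v) g = s ^ e * eval v g := by
  rw [eval_eq, eval_eq, Finset.mul_sum]
  refine Finset.sum_congr rfl fun m hm => ?_
  have := IsHomogeneous.degree_eq_sum_deg_support hg hm
  simp only [Pi.smul_apply, smul_eq_mul, mul_pow, Finset.prod_mul_distrib]
  rw [Finset.prod_pow_eq_pow_sum, this]
  ring

/-- Two independent vectors of a plane in three-space span it. -/
theorem exists_eq_combination {c u w r : Fin 3 → ℂ} (hc : c ≠ 0) (hu : ∑ i, c i * u i = 0)
    (hw : ∑ i, c i * w i = 0) (hr : ∑ i, c i * r i = 0) (hu0 : u ≠ 0)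
    (huw : ∀ a : ℂ, w ≠ a • u) : ∃ a b : ℂ, r = a • u + b • w := by
  -- The nonzero vector `c` annihilates all three rows.
  have hdet : (Matrix.of ![u, w, r]).det = 0 := by
    rw [← Matrix.exists_mulVec_eq_zero_iff]
    refine ⟨c, hc, ?_⟩
    funext i
    fin_cases i <;> simp [Matrix.mulVec, dotProduct, mul_comm _ (c _), hu, hw, hr]
  obtain ⟨t, ht, h⟩ := Matrix.exists_vecMul_eq_zero_iff.2 hdet
  have h' : t 0 • u + t 1 • w + t 2 • r = 0 := by
    rw [← h]
    funext i
    simp [Matrix.vecMul, dotProduct, Fin.sum_univ_three]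
  have h2 : t 2 ≠ 0 := by
    intro h2
    rw [h2, zero_smul, add_zero] at h'
    by_cases h1 : t 1 = 0
    · rw [h1, zero_smul, add_zero] at h'
      rcases smul_eq_zero.1 h' with h0 | h0
      · apply ht
        funext i
        fin_cases i <;> simp [h0, h1, h2]
      · exact hu0 h0
    · apply huw (-((t 1)⁻¹ * t 0))
      have : t 1 • w = -(t 0 • u) := by rw [eq_neg_iff_add_eq_zero, add_comm, h']
      rw [neg_smul, mul_smul, ← smul_neg, ← this, smul_smul, inv_mul_cancel₀ h1, one_smul]
  refine ⟨-((t 2)⁻¹ * t 0), -((t 2)⁻¹ * t 1), ?_⟩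
  have : t 2 • r = -(t 0 • u + t 1 • w) := by rw [eq_neg_iff_add_eq_zero, add_comm, h']
  calc r = (t 2)⁻¹ • (t 2 • r) := by rw [smul_smul, inv_mul_cancel₀ h2, one_smul]
    _ = _ := by rw [this]; module

theorem eq_of_rep_eq_smul {P Q : P2} {a : ℂ} (h : P.rep = a • Q.rep) : P = Q := by
  rw [← P.mk_rep, ← Q.mk_rep, Projectivization.mk_eq_mk_iff']
  exact ⟨a, h.symm⟩

/-- A form of degree `e` that vanishes at more than `e` points of a line is divisible by the
equation of the line. -/
theorem lineForm_dvd_of_card {c : Fin 3 → ℂ} (hc : c ≠ 0) {g : Poly} {e : ℕ}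
    (hg : g.IsHomogeneous e) {S : Finset P2} (hS : e < S.card)
    (hline : ∀ P ∈ S, P ∈ zeroSet (lineForm c)) (hzero : ∀ P ∈ S, eval P.rep g = 0) :
    lineForm c ∣ g := by
  refine lineForm_dvd_of_eval hc fun w hw => ?_
  obtain ⟨P₀, hP₀⟩ : S.Nonempty := Finset.card_pos.1 (by omega)
  have hker : ∀ P ∈ S, ∑ i, c i * P.rep i = 0 := fun P hP => by
    rw [← eval_lineForm]; exact hline P hP
  by_cases hpar : ∃ a : ℂ, w = a • P₀.rep
  · obtain ⟨a, rfl⟩ := hpar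
    rw [eval_smul_of_isHomogeneous hg, hzero _ hP₀, mul_zero]
  push Not at hpar
  have hcomb : ∀ P : P2, ∃ ab : ℂ × ℂ, P ∈ S → P.rep = ab.1 • P₀.rep + ab.2 • w := by
    intro P
    by_cases hP : P ∈ S
    · obtain ⟨a, b, h⟩ := exists_eq_combination hc (hker _ hP₀) hw (hker P hP)
        P₀.rep_nonzero hpar
      exact ⟨(a, b), fun _ => h⟩
    · exact ⟨0, fun h => absurd h hP⟩
  choose ab hab using hcomb
  -- A point with zero first coordinate is the class of `w` itself; otherwise all of `S` lies in the
  -- affine chart used below.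
  by_cases hα : ∃ P ∈ S, (ab P).1 = 0
  · obtain ⟨P, hP, h0⟩ := hα
    have h1 := hab P hP
    rw [h0, zero_smul, zero_add] at h1
    have hb : (ab P).2 ≠ 0 := by
      intro hb
      rw [hb, zero_smul] at h1
      exact P.rep_nonzero h1
    have h2 : eval P.rep g = _ := congrArg (fun v => eval v g) h1
    rw [hzero P hP] at h2
    simp only [eval_smul_of_isHomogeneous hg] at h2
    rcases mul_eq_zero.1 h2.symm with h | h
    · exact absurd h (pow_ne_zero _ hb)
    · exact h
  push Not at hα
  -- The restriction of `g` to the affine line through `P₀.rep` in direction `w`.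
  set G : Polynomial ℂ :=
    aeval (fun i => Polynomial.C (P₀.rep i) + Polynomial.C (w i) * Polynomial.X) g with hG
  have hGeval : ∀ t : ℂ, G.eval t = eval (P₀.rep + t • w) g := by
    intro t
    have : ((Polynomial.aeval t : Polynomial ℂ →ₐ[ℂ] ℂ).comp
        (aeval fun i => Polynomial.C (P₀.rep i) + Polynomial.C (w i) * Polynomial.X)) =
        (aeval (P₀.rep + t • w) : Poly →ₐ[ℂ] ℂ) := by
      ext i
      simp only [AlgHom.comp_apply, aeval_X, map_add, map_mul, Polynomial.aeval_C,
        Polynomial.aeval_X, Algebra.algebraMap_self_apply, Pi.add_apply, Pi.smul_apply,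
        smul_eq_mul, mul_comm]
    have h := congrArg (fun φ => φ g) this
    simp only [AlgHom.comp_apply, aeval_eq_eval] at h
    rw [← h, Polynomial.coe_aeval_eq_eval]
  have hdeg : G.natDegree ≤ e := by
    have := aeval_natDegree_le g (m := e) (hg.totalDegree_le)
      (fun i => Polynomial.C (P₀.rep i) + Polynomial.C (w i) * Polynomial.X) (n := 1)
      (fun i => by compute_degree)
    simpa using this
  have hroot : ∀ P ∈ S, G.eval ((ab P).2 / (ab P).1) = 0 := by
    intro P hP
    have h1 : P₀.rep + ((ab P).2 / (ab P).1) • w = (ab P).1⁻¹ • P.rep := by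
      rw [hab P hP, smul_add, smul_smul, smul_smul, inv_mul_cancel₀ (hα P hP), one_smul,
        div_eq_inv_mul]
    rw [hGeval, h1, eval_smul_of_isHomogeneous hg, hzero P hP, mul_zero]
  have hinj : Set.InjOn (fun P => (ab P).2 / (ab P).1) (S : Set P2) := by
    intro P hP Q hQ hPQ
    simp only at hPQ
    have hp := hα P hP
    have hq := hα Q hQ
    refine eq_of_rep_eq_smul (a := (ab P).1 / (ab Q).1) ?_
    rw [hab P hP, hab Q hQ, smul_add, smul_smul, smul_smul, div_mul_cancel₀ _ hq]
    congr 2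
    field_simp at hPQ ⊢
    linear_combination hPQ
  have hG0 : G = 0 := by
    refine Polynomial.eq_zero_of_natDegree_lt_card_of_eval_eq_zero' G
      (S.image fun P => (ab P).2 / (ab P).1) ?_ ?_
    · simp only [Finset.mem_image]
      rintro _ ⟨P, hP, rfl⟩
      exact hroot P hP
    · rw [Finset.card_image_of_injOn hinj]
      omega
  -- The restriction of `g` to the affine line through `w` in direction `P₀.rep`.
  have hlim : ∀ s : ℂ, s ≠ 0 → eval (s • P₀.rep + w) g = 0 := by
    intro s hs
    have h1 : s • P₀.rep + w = s • (P₀.rep + s⁻¹ • w) := by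
      rw [smul_add, smul_smul, mul_inv_cancel₀ hs, one_smul]
    rw [h1, eval_smul_of_isHomogeneous hg, ← hGeval, hG0, Polynomial.eval_zero, mul_zero]
  -- The vector `w` is the case s = 0, reached by continuity.
  have hcont : Continuous fun s : ℂ => eval (s • P₀.rep + w) g :=
    (MvPolynomial.continuous_eval g).comp (by fun_prop)
  have := hcont.ext_on (dense_compl_singleton (0 : ℂ)) continuous_const
    (fun s hs => hlim s hs)
  simpa using congrFun this 0

/-- A form divisible by a linear form has a form as quotient. -/
theorem exists_isHomogeneous_eq_mul {l g : Poly} {n : ℕ} (hl : l.IsHomogeneous 1)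
    (hg : g.IsHomogeneous (n + 1)) (h : l ∣ g) : ∃ c : Poly, c.IsHomogeneous n ∧ g = l * c := by
  obtain ⟨c, rfl⟩ := h
  -- The degree `n` component is a form by construction, and comparing degrees shows that it is a
  -- quotient too.
  refine ⟨homogeneousComponent n c, homogeneousComponent_isHomogeneous n c, ?_⟩
  let _ := gradedAlgebra (σ := Fin 3) (R := ℂ)
  have h := DirectSum.coe_decompose_mul_add_of_left_mem (homogeneousSubmodule (Fin 3) ℂ)
    (i := 1) (j := n) (a := l) (b := c) hl
  have h' : homogeneousComponent (1 + n) (l * c) = l * homogeneousComponent n c := by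
    rw [← decomposition.decompose'_apply, ← decomposition.decompose'_apply]
    exact h
  rw [← h', homogeneousComponent_eq_self (by rwa [add_comm])]

/-- Fewer than `n` linear functionals on `ℂ ^ n` have a nontrivial common zero. -/
theorem exists_ne_zero_forall_eq_zero {n : ℕ} {ι : Type*} (S : Finset ι)
    (φ : ι → (Fin n → ℂ) →ₗ[ℂ] ℂ) (h : S.card < n) : ∃ v, v ≠ 0 ∧ ∀ i ∈ S, φ i v = 0 := by
  have hker := LinearMap.ker_ne_bot_of_finrank_lt
    (f := LinearMap.pi fun i : S => φ i) (by simpa using h)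
  obtain ⟨v, hv, hv0⟩ := Submodule.exists_mem_ne_zero_of_ne_bot hker
  exact ⟨v, hv0, fun i hi => congrFun hv ⟨i, hi⟩⟩

open scoped ComplexOrder in
-- The points [u + t w] lie on the line when u, w do; taking w orthogonal to u makes them distinct.
-- This supplies a point of the line off f.
theorem infinite_zeroSet_lineForm (c : Fin 3 → ℂ) : (zeroSet (lineForm c)).Infinite := by
  let dot (a : Fin 3 → ℂ) : (Fin 3 → ℂ) →ₗ[ℂ] ℂ := ∑ i, a i • LinearMap.proj i
  have hdot : ∀ a v, dot a v = ∑ i, a i * v i := fun a v => by simp [dot]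
  obtain ⟨u, hu0, hu⟩ := exists_ne_zero_forall_eq_zero (n := 3) {()} (fun _ => dot c) (by simp)
  obtain ⟨w, hw0, hw⟩ := exists_ne_zero_forall_eq_zero (n := 3) Finset.univ
    (fun b : Bool => if b then dot c else dot (star u)) (by simp)
  replace hu : dot c u = 0 := hu () (by simp)
  have hw1 : dot c w = 0 := by simpa using hw true (by simp)
  have hw2 : dot (star u) w = 0 := by simpa using hw false (by simp)
  have huu : dot (star u) u ≠ 0 := by
    have : dot (star u) u = star u ⬝ᵥ u := hdot _ _
    rw [this]
    rwa [Ne, dotProduct_star_self_eq_zero]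
  have hne : ∀ t : ℂ, u + t • w ≠ 0 := by
    intro t h
    apply huu
    have := congrArg (dot (star u)) h
    simpa [hw2] using this
  refine Set.infinite_of_injective_forall_mem
    (f := fun t : ℂ => (Projectivization.mk ℂ (u + t • w) (hne t) : P2)) ?_ ?_
  · intro t t' h
    simp only at h
    rw [Projectivization.mk_eq_mk_iff'] at h
    obtain ⟨a, ha⟩ := h
    have h1 := congrArg (dot (star u)) ha
    simp only [map_smul, map_add, hw2, smul_eq_mul, mul_zero, add_zero] at h1
    have ha1 : a = 1 := mul_right_cancel₀ huu (by rw [h1, one_mul])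
    rw [ha1, one_smul, add_right_inj] at ha
    exact (smul_left_injective ℂ hw0 ha).symm
  · intro t
    obtain ⟨a, ha⟩ := Projectivization.exists_smul_eq_mk_rep ℂ (u + t • w) (hne t)
    change eval _ _ = 0
    rw [← ha, eval_lineForm, ← hdot, Units.smul_def, map_smul, map_add, map_smul, hu, hw1]
    simp

/-! ### The sesquilinear form of A and its minors. -/

variable {d : ℕ}

/-- The sesquilinear form `(v, w) ↦ vᵀ A w̄` of a matrix of polynomials. -/
noncomputable def sesq (A : Matrix (Fin d) (Fin d) Poly) (v w : Fin d → ℂ) : Poly :=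
  ∑ j, ∑ k, C (v j) * A j k * C (starRingEnd ℂ (w k))

/-- `sesq A` as a linear map in its first argument. -/
noncomputable def sesqLeft (A : Matrix (Fin d) (Fin d) Poly) (w : Fin d → ℂ) :
    (Fin d → ℂ) →ₗ[ℂ] Poly where
  toFun v := sesq A v w
  map_add' v v' := by
    simp only [sesq, Pi.add_apply, C_add, add_mul, Finset.sum_add_distrib]
  map_smul' s v := by
    simp only [sesq, Pi.smul_apply, smul_eq_mul, C_mul, smul_eq_C_mul, Finset.mul_sum,
      mul_assoc, RingHom.id_apply]

@[simp]
theorem sesqLeft_apply (A : Matrix (Fin d) (Fin d) Poly) (v w : Fin d → ℂ) :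
    sesqLeft A w v = sesq A v w := rfl

theorem sesq_isHomogeneous {A : Matrix (Fin d) (Fin d) Poly} {n : ℕ}
    (hA : ∀ j k, (A j k).IsHomogeneous n) (v w : Fin d → ℂ) : (sesq A v w).IsHomogeneous n :=
  IsHomogeneous.sum _ _ _ fun j _ => IsHomogeneous.sum _ _ _ fun k _ => by
    rw [mul_comm]
    exact ((hA j k).C_mul _).C_mul _

theorem conjPoly_toComplex (f : MvPolynomial (Fin 3) ℝ) :
    conjPoly (toComplex f) = toComplex f := by
  simp only [conjPoly, toComplex, map_map]
  exact congrArg (fun φ => MvPolynomial.map φ f) (RingHom.ext Complex.conj_ofReal)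

theorem conjPoly_dvd {g h : Poly} (hgh : g ∣ h) : conjPoly g ∣ conjPoly h :=
  map_dvd (MvPolynomial.map (starRingEnd ℂ)) hgh

theorem eval_conjPoly (u : Fin 3 → ℂ) (g : Poly) :
    eval u (conjPoly g) = starRingEnd ℂ (eval (star u) g) := by
  rw [conjPoly, eval_map, ← coe_eval₂Hom, eval, ← RingHom.comp_apply]
  congr 1
  apply MvPolynomial.ringHom_ext <;> simp

theorem conjPoly_sesq {A : Matrix (Fin d) (Fin d) Poly}
    (hA : ∀ j k, A k j = conjPoly (A j k)) (v w : Fin d → ℂ) :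
    conjPoly (sesq A v w) = sesq A w v := by
  have h : ∀ j k, MvPolynomial.map (starRingEnd ℂ) (A j k) = A k j := fun j k => (hA j k).symm
  simp only [sesq, conjPoly, map_sum, map_mul, map_C, Complex.conj_conj, h]
  rw [Finset.sum_comm]
  exact Finset.sum_congr rfl fun k _ => Finset.sum_congr rfl fun j _ => by ring

/-- `f` divides the minors of order two of every matrix of the Dixon construction. -/
theorem IsDixonMatrix.dvd_minor [NeZero d] {f : MvPolynomial (Fin 3) ℝ} {D : P2 →₀ ℤ}
    {A : Matrix (Fin d) (Fin d) Poly} (hA : IsDixonMatrix f D A) (v w v' w' : Fin d → ℂ) :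
    toComplex f ∣ sesq A v w * sesq A v' w' - sesq A v w' * sesq A v' w := by
  have hle : ∀ j k, j ≤ k → toComplex f ∣ A 0 0 * A j k - A j 0 * A 0 k := by
    intro j k hjk
    by_cases hj : j = 0
    · subst hj; simp
    · obtain ⟨p, hp⟩ := hA.entry j k hj hjk
      rw [← hA.hermitian] at hp
      exact ⟨-p, by linear_combination -hp⟩
  have hall : ∀ j k, toComplex f ∣ A 0 0 * A j k - A j 0 * A 0 k := by
    intro j k
    -- The construction constrains only j ≤ k; conjugation gives the other half.
    rcases le_total j k with h | h
    · exact hle j k h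
    · have hconj : conjPoly (A 0 0 * A k j - A k 0 * A 0 j) =
          conjPoly (A 0 0) * conjPoly (A k j) - conjPoly (A k 0) * conjPoly (A 0 j) := by
        simp only [conjPoly, map_sub, map_mul]
      have := conjPoly_dvd (hle k j h)
      rw [conjPoly_toComplex, hconj] at this
      simp only [← hA.hermitian] at this
      rwa [mul_comm (A j 0)]
  have hfac : ∀ v w : Fin d → ℂ, toComplex f ∣ A 0 0 * sesq A v w -
      (∑ j, C (v j) * A j 0) * ∑ k, A 0 k * C (starRingEnd ℂ (w k)) := by
    intro v w
    rw [sesq, Finset.sum_mul_sum, Finset.mul_sum, ← Finset.sum_sub_distrib]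
    refine Finset.dvd_sum fun j _ => ?_
    rw [Finset.mul_sum, ← Finset.sum_sub_distrib]
    refine Finset.dvd_sum fun k _ => ?_
    refine (hall j k).trans ⟨C (v j) * C (starRingEnd ℂ (w k)), by ring⟩
  -- Modulo f, a₁₁⟨v,w⟩ is a factor in v times a factor in w, so a₁₁² times the minor is zero; a₁₁
  -- is prime to f.
  have hrel : IsRelPrime (toComplex f) (A 0 0 ^ 2) := hA.corner.1.pow_right
  refine hrel.dvd_of_dvd_mul_left ?_
  obtain ⟨p, hp⟩ := hfac v w
  obtain ⟨p', hp'⟩ := hfac v' w'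
  obtain ⟨q, hq⟩ := hfac v w'
  obtain ⟨q', hq'⟩ := hfac v' w
  refine ⟨p * (A 0 0 * sesq A v' w') +
    (∑ j, C (v j) * A j 0) * (∑ k, A 0 k * C (starRingEnd ℂ (w k))) * p' -
    (q * (A 0 0 * sesq A v' w) +
    (∑ j, C (v j) * A j 0) * (∑ k, A 0 k * C (starRingEnd ℂ (w' k))) * q'), ?_⟩
  linear_combination (A 0 0 * sesq A v' w') * hp +
    (∑ j, C (v j) * A j 0) * (∑ k, A 0 k * C (starRingEnd ℂ (w k))) * hp' -
    (A 0 0 * sesq A v' w) * hq -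
    (∑ j, C (v j) * A j 0) * (∑ k, A 0 k * C (starRingEnd ℂ (w' k))) * hq'

theorem dvd_of_dvd_lineForm_mul {c : Fin 3 → ℂ} (hc : c ≠ 0) {F x : Poly}
    (hF : ¬ lineForm c ∣ F) (h : F ∣ lineForm c * x) : F ∣ x := by
  obtain ⟨p, hp⟩ := h
  rcases lineForm_dvd_mul hc (Dvd.intro _ hp) with h | ⟨p', rfl⟩
  · exact absurd h hF
  · exact ⟨p', mul_left_cancel₀ (lineForm_ne_zero hc) (by rw [hp]; ring)⟩

theorem eval_eq_zero_of_dvd {F g : Poly} {u : Fin 3 → ℂ} (h : F ∣ g) (hF : eval u F = 0) :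
    eval u g = 0 := by
  obtain ⟨p, rfl⟩ := h
  rw [map_mul, hF, zero_mul]

/-! ### Linear conditions at the points of the line and the curve. -/

section

variable {A : Matrix (Fin d) (Fin d) Poly} {F : Poly} {c : Fin 3 → ℂ} {u : Fin 3 → ℂ}

/-- At a zero of `F`, a matrix whose minors of order two are divisible by `F` has rank at most
one, so its left kernel contains that of a linear functional. -/
theorem exists_functional_left
    (hminor : ∀ v w v' w', F ∣ sesq A v w * sesq A v' w' - sesq A v w' * sesq A v' w)
    (hu : eval u F = 0) :
    ∃ φ : (Fin d → ℂ) →ₗ[ℂ] ℂ, ∀ v, φ v = 0 → ∀ w, eval u (sesq A v w) = 0 := by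
  by_cases h : ∃ a b, eval u (sesq A a b) ≠ 0
  · obtain ⟨a, b, hab⟩ := h
    refine ⟨(aeval u).toLinearMap ∘ₗ sesqLeft A b, fun v hv w => ?_⟩
    have hv' : eval u (sesq A v b) = 0 := by simpa [aeval_eq_eval] using hv
    have := eval_eq_zero_of_dvd (hminor v w a b) hu
    simp only [map_sub, map_mul, hv', zero_mul, sub_zero] at this
    exact (mul_eq_zero.1 this).resolve_right hab
  · push Not at h
    exact ⟨0, fun v _ w => h v w⟩

/-- The counterpart of `exists_functional_left` for the second argument. -/
theorem exists_functional_right (hherm : ∀ j k, A k j = conjPoly (A j k))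
    (hminor : ∀ v w v' w', F ∣ sesq A v w * sesq A v' w' - sesq A v w' * sesq A v' w)
    (hu : eval u F = 0) :
    ∃ φ : (Fin d → ℂ) →ₗ[ℂ] ℂ, ∀ w, φ w = 0 → ∀ v, eval u (sesq A v w) = 0 := by
  by_cases h : ∃ a b, eval u (sesq A a b) ≠ 0
  · obtain ⟨a, b, hab⟩ := h
    -- ⟨a,w⟩ is conjugate-linear in w; evaluating ⟨w,a⟩ at the conjugate point makes the condition
    -- linear.
    refine ⟨(aeval (star u)).toLinearMap ∘ₗ sesqLeft A a, fun w hw v => ?_⟩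
    have hw' : eval u (sesq A a w) = 0 := by
      rw [← conjPoly_sesq hherm, eval_conjPoly]
      have : eval (star u) (sesq A w a) = 0 := by simpa [aeval_eq_eval] using hw
      rw [this, map_zero]
    have := eval_eq_zero_of_dvd (hminor v w a b) hu
    simp only [map_sub, map_mul, hw', mul_zero, sub_zero] at this
    exact (mul_eq_zero.1 this).resolve_right hab
  · push Not at h
    exact ⟨0, fun w _ v => h v w⟩

theorem lineForm_dvd_sesq_swap (hherm : ∀ j k, A k j = conjPoly (A j k))
    (hcr : conjPoly (lineForm c) = lineForm c) {v w : Fin d → ℂ}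
    (h : lineForm c ∣ sesq A v w) : lineForm c ∣ sesq A w v := by
  rw [← conjPoly_sesq hherm, ← hcr]
  exact conjPoly_dvd h

/-- If the line divides the row `vᵀ A`, then the residual curve of `vᵀ A v̄` passes through the
points of the line and of `F` at which `A` does not vanish. -/
theorem eval_quotient_eq_zero (hherm : ∀ j k, A k j = conjPoly (A j k))
    (hminor : ∀ v w v' w', F ∣ sesq A v w * sesq A v' w' - sesq A v w' * sesq A v' w)
    (hc : c ≠ 0) (hcr : conjPoly (lineForm c) = lineForm c) (hF : ¬ lineForm c ∣ F)
    (hu : eval u F = 0) (hul : eval u (lineForm c) = 0) {v a b : Fin d → ℂ}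
    (hab : eval u (sesq A a b) ≠ 0) (hv : ∀ w, lineForm c ∣ sesq A v w) {q : Poly}
    (hq : sesq A v v = lineForm c * q) : eval u q = 0 := by
  obtain ⟨x, hx⟩ := hv b
  obtain ⟨y, hy⟩ := lineForm_dvd_sesq_swap hherm hcr (hv a)
  -- The second product of the minor contains ℓ², so one ℓ survives the cancellation and vanishes at
  -- `u`.
  have h : F ∣ q * sesq A a b - lineForm c * x * y := by
    refine dvd_of_dvd_lineForm_mul hc hF ((hminor v v a b).trans (dvd_of_eq ?_))
    rw [hq, hx, hy]
    ring
  have := eval_eq_zero_of_dvd h hu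
  simp only [map_sub, map_mul, hul, zero_mul, sub_zero] at this
  exact (mul_eq_zero.1 this).resolve_right hab

/-- Among the `v` such that the line divides the row `vᵀ A`, those for which the residual curve of
`vᵀ A v̄` passes through a given point of the line and of `F` contain the kernel of a linear
functional. -/
theorem exists_functional_quotient
    (hminor : ∀ v w v' w', F ∣ sesq A v w * sesq A v' w' - sesq A v w' * sesq A v' w)
    (hc : c ≠ 0) (hF : ¬ lineForm c ∣ F)
    (hu : eval u F = 0) (hul : eval u (lineForm c) = 0) :
    ∃ χ : (Fin d → ℂ) →ₗ[ℂ] ℂ, ∀ v, (∀ w, lineForm c ∣ sesq A v w) → χ v = 0 →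
      ∀ q, sesq A v v = lineForm c * q → eval u q = 0 := by
  by_cases h : ∃ a b x, (∀ w, lineForm c ∣ sesq A a w) ∧ sesq A a b = lineForm c * x ∧
      eval u x ≠ 0
  · obtain ⟨a, b, x, ha, hx, hx0⟩ := h
    obtain ⟨k, hk⟩ := Function.ne_iff.1 hc
    -- If ⟨v,b⟩ = ℓy, this derivative at `u` is c_k y(u). It replaces division by ℓ with a
    -- functional defined for every v.
    refine ⟨(aeval u).toLinearMap ∘ₗ (pderiv k).toLinearMap ∘ₗ sesqLeft A b,
      fun v hv hχ q hq => ?_⟩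
    obtain ⟨y, hy⟩ := hv b
    obtain ⟨z, hz⟩ := ha v
    have hy0 : eval u y = 0 := by
      have : eval u (pderiv k (sesq A v b)) = 0 := by simpa [aeval_eq_eval] using hχ
      rw [hy, pderiv_mul, pderiv_lineForm, map_add, map_mul, map_mul, hul, zero_mul, add_zero,
        eval_C] at this
      exact (mul_eq_zero.1 this).resolve_left hk
    have h : F ∣ q * x - y * z := by
      refine dvd_of_dvd_lineForm_mul hc hF (dvd_of_dvd_lineForm_mul hc hF
        ((hminor v v a b).trans (dvd_of_eq ?_)))
      rw [hq, hx, hy, hz]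
      ring
    have := eval_eq_zero_of_dvd h hu
    simp only [map_sub, map_mul, hy0, zero_mul, sub_zero] at this
    exact (mul_eq_zero.1 this).resolve_right hx0
  · push Not at h
    exact ⟨0, fun v hv _ q hq => h v v q hv hq⟩

theorem lineForm_sq_dvd_sesq {n : ℕ} (hhom : ∀ j k, (A j k).IsHomogeneous (n + 1)) (hc : c ≠ 0)
    {S : Finset P2} (hS : n < S.card) (hline : ∀ P ∈ S, P ∈ zeroSet (lineForm c))
    {v : Fin d → ℂ} (hv : lineForm c ∣ sesq A v v)
    (hq : ∀ P ∈ S, ∀ q, sesq A v v = lineForm c * q → eval P.rep q = 0) :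
    lineForm c ^ 2 ∣ sesq A v v := by
  obtain ⟨q, hqh, hvq⟩ := exists_isHomogeneous_eq_mul (lineForm_isHomogeneous c)
    (sesq_isHomogeneous hhom v v) hv
  rw [hvq, pow_two]
  exact mul_dvd_mul_left _ (lineForm_dvd_of_card hc hqh hS hline fun P hP => hq P hP q hvq)

/-- A singular Hermitian matrix of forms of degree `n` whose minors of order two vanish at `n + 1`
points of a line has a combination of its rows that is divisible by the equation of the line. -/
theorem exists_lineForm_dvd_sesq {n : ℕ} (hhom : ∀ j k, (A j k).IsHomogeneous n)
    (hherm : ∀ j k, A k j = conjPoly (A j k))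
    (hminor : ∀ v w v' w', F ∣ sesq A v w * sesq A v' w' - sesq A v w' * sesq A v' w)
    (hc : c ≠ 0) (hcr : conjPoly (lineForm c) = lineForm c) {Z : Finset P2} (hd : Z.card = d)
    (hn : d = n + 1) (hline : ∀ P ∈ Z, P ∈ zeroSet (lineForm c))
    (hZ : ∀ P ∈ Z, eval P.rep F = 0) {Q : P2}
    (hQ : Q ∈ zeroSet (lineForm c)) (hQZ : Q ∉ Z) (hdet : A.det = 0) :
    ∃ v, v ≠ 0 ∧ ∀ w, lineForm c ∣ sesq A v w := by
  classical
  by_contra! hcon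
  -- The row of a left kernel vector μ of A(Q) will be shown to vanish on Z, against `hcon`.
  obtain ⟨μ, hμ0, hμ⟩ : ∃ μ : Fin d → ℂ, μ ≠ 0 ∧ ∀ w, eval Q.rep (sesq A μ w) = 0 := by
    have hdetQ : ((eval Q.rep).mapMatrix A).det = 0 := by
      rw [← RingHom.map_det, hdet, map_zero]
    obtain ⟨μ, hμ0, hμ⟩ := Matrix.exists_vecMul_eq_zero_iff.2 hdetQ
    refine ⟨μ, hμ0, fun w => ?_⟩
    rw [sesq, Finset.sum_comm, map_sum]
    refine Finset.sum_eq_zero fun k _ => ?_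
    have := congrFun hμ k
    simp only [Matrix.vecMul, dotProduct, RingHom.mapMatrix_apply, Matrix.map_apply,
      Pi.zero_apply] at this
    simp only [map_sum, map_mul, eval_C, ← Finset.sum_mul, this, zero_mul]
  obtain ⟨w, hw⟩ := hcon μ hμ0
  apply hw
  refine lineForm_dvd_of_card hc (sesq_isHomogeneous hhom μ w) (S := Z) (by omega) hline ?_
  intro P₀ hP₀
  have hfun : ∀ P : P2, ∃ φ : (Fin d → ℂ) →ₗ[ℂ] ℂ, P ∈ Z → ∀ w, φ w = 0 →
      ∀ v, eval P.rep (sesq A v w) = 0 := by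
    intro P
    by_cases hP : P ∈ Z
    · obtain ⟨φ, hφ⟩ := exists_functional_right hherm hminor (hZ P hP)
      exact ⟨φ, fun _ => hφ⟩
    · exact ⟨0, fun h => absurd h hP⟩
  choose φ hφ using hfun
  -- The column of κ vanishes on Z except possibly at P₀. With Q as a d-th zero, ℓ divides ⟨μ,κ⟩;
  -- the minor at P₀ then forces ⟨μ,w⟩(P₀) = 0.
  obtain ⟨κ, hκ0, hκ⟩ := exists_ne_zero_forall_eq_zero (Z.erase P₀) φ
    (by rw [Finset.card_erase_of_mem hP₀]; omega)
  have hκ' : ∀ P ∈ Z.erase P₀, ∀ v, eval P.rep (sesq A v κ) = 0 := fun P hP =>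
    hφ P (Finset.mem_of_mem_erase hP) κ (hκ P hP)
  have hμκ : lineForm c ∣ sesq A μ κ := by
    refine lineForm_dvd_of_card hc (sesq_isHomogeneous hhom μ κ)
      (S := insert Q (Z.erase P₀)) ?_ ?_ ?_
    · rw [Finset.card_insert_of_notMem fun h => hQZ (Finset.mem_of_mem_erase h),
        Finset.card_erase_of_mem hP₀]
      omega
    · intro P hP
      rcases Finset.mem_insert.1 hP with rfl | hP
      · exact hQ
      · exact hline P (Finset.mem_of_mem_erase hP)
    · intro P hP
      rcases Finset.mem_insert.1 hP with rfl | hP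
      · exact hμ κ
      · exact hκ' P hP μ
  -- Otherwise ℓ divides the whole column of κ, hence its row by Hermitian symmetry.
  obtain ⟨v, hv⟩ : ∃ v, eval P₀.rep (sesq A v κ) ≠ 0 := by
    by_contra! hall
    obtain ⟨w, hw⟩ := hcon κ hκ0
    refine hw (lineForm_dvd_sesq_swap hherm hcr ?_)
    refine lineForm_dvd_of_card hc (sesq_isHomogeneous hhom w κ) (S := Z) (by omega) hline ?_
    intro P hP
    by_cases h : P = P₀
    · rw [h]; exact hall w
    · exact hκ' P (Finset.mem_erase.2 ⟨h, hP⟩) w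
  have := eval_eq_zero_of_dvd (hminor μ w v κ) (hZ P₀ hP₀)
  simp only [map_sub, map_mul, eval_eq_zero_of_dvd hμκ (hline P₀ hP₀), zero_mul, sub_zero]
    at this
  exact (mul_eq_zero.1 this).resolve_right hv

theorem exists_lineForm_sq_dvd_sesq {n : ℕ} (hhom : ∀ j k, (A j k).IsHomogeneous (n + 1))
    (hherm : ∀ j k, A k j = conjPoly (A j k))
    (hminor : ∀ v w v' w', F ∣ sesq A v w * sesq A v' w' - sesq A v w' * sesq A v' w)
    (hc : c ≠ 0) (hcr : conjPoly (lineForm c) = lineForm c) (hF : ¬ lineForm c ∣ F)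
    {Z : Finset P2} (hd : Z.card = d)
    (hn : d = n + 2) (hline : ∀ P ∈ Z, P ∈ zeroSet (lineForm c))
    (hZ : ∀ P ∈ Z, eval P.rep F = 0) {Q : P2}
    (hQ : Q ∈ zeroSet (lineForm c)) (hQZ : Q ∉ Z) (hdet : A.det = 0) :
    ∃ v, v ≠ 0 ∧ lineForm c ^ 2 ∣ sesq A v v := by
  classical
  by_cases hgood : ∀ P ∈ Z, ∃ a b, eval P.rep (sesq A a b) ≠ 0
  · obtain ⟨v, hv0, hv⟩ := exists_lineForm_dvd_sesq hhom hherm hminor hc hcr hd hn hline hZ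
      hQ hQZ hdet
    refine ⟨v, hv0, lineForm_sq_dvd_sesq hhom hc (S := Z) (by omega) hline (hv v) ?_⟩
    intro P hP q hq
    obtain ⟨a, b, hab⟩ := hgood P hP
    exact eval_quotient_eq_zero hherm hminor hc hcr hF (hZ P hP) (hline P hP) hab hv hq
  push Not at hgood
  obtain ⟨P₀, hP₀, hbad₀⟩ := hgood
  have hfun : ∀ P : P2, ∃ φ : (Fin d → ℂ) →ₗ[ℂ] ℂ, P ∈ Z → ∀ v, φ v = 0 →
      (∀ w, eval P.rep (sesq A v w) = 0) ∧ ((∀ w, lineForm c ∣ sesq A v w) →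
        ∀ q, sesq A v v = lineForm c * q → eval P.rep q = 0) := by
    intro P
    by_cases hP : P ∈ Z
    · by_cases hgood : ∃ a b, eval P.rep (sesq A a b) ≠ 0
      · obtain ⟨a, b, hab⟩ := hgood
        obtain ⟨φ, hφ⟩ := exists_functional_left hminor (hZ P hP)
        exact ⟨φ, fun _ v hv => ⟨hφ v hv, fun hdvd q hq => eval_quotient_eq_zero hherm hminor
          hc hcr hF (hZ P hP) (hline P hP) hab hdvd hq⟩⟩
      · push Not at hgood
        obtain ⟨χ, hχ⟩ := exists_functional_quotient hminor hc hF (hZ P hP) (hline P hP)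
        exact ⟨χ, fun _ v hv => ⟨hgood v, fun hdvd => hχ v hdvd hv⟩⟩
    · exact ⟨0, fun h => absurd h hP⟩
  choose φ hφ using hfun
  have hcard : (Z.erase P₀).card = n + 1 := by rw [Finset.card_erase_of_mem hP₀]; omega
  obtain ⟨v, hv0, hv⟩ := exists_ne_zero_forall_eq_zero (Z.erase P₀) φ (by omega)
  have hdvd : ∀ w, lineForm c ∣ sesq A v w := by
    intro w
    refine lineForm_dvd_of_card hc (sesq_isHomogeneous hhom v w) (S := Z) (by omega) hline ?_
    intro P hP
    by_cases h : P = P₀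
    · rw [h]; exact hbad₀ v w
    · exact (hφ P hP v (hv P (Finset.mem_erase.2 ⟨h, hP⟩))).1 w
  -- The n + 1 points other than P₀ exceed deg q = n.
  refine ⟨v, hv0, lineForm_sq_dvd_sesq hhom hc (S := Z.erase P₀) (by omega)
    (fun P hP => hline P (Finset.mem_of_mem_erase hP)) (hdvd v) fun P hP => ?_⟩
  exact (hφ P (Finset.mem_of_mem_erase hP) v (hv P hP)).2 hdvd

end

/-! ### From the rational matrix back to A, and the conclusion. -/

theorem det_eq_zero_of_det_dixonRep {f : MvPolynomial (Fin 3) ℝ} (hf : f ≠ 0)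
    {A : Matrix (Fin d) (Fin d) Poly} (h : (dixonRep f A).det = 0) : A.det = 0 := by
  have hf' : algebraMap Poly (FractionRing Poly) (toComplex f) ≠ 0 := by
    rw [Ne, map_eq_zero_iff _ (IsFractionRing.injective Poly (FractionRing Poly)), toComplex,
      map_eq_zero_iff _ (map_injective _ Complex.ofRealHom.injective)]
    exact hf
  rw [dixonRep, Matrix.det_smul] at h
  have h1 := (mul_eq_zero.1 h).resolve_left
    (pow_ne_zero _ (one_div_ne_zero (zpow_ne_zero _ hf')))
  have h2 : algebraMap Poly (FractionRing Poly) A.adjugate.det = 0 := by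
    rw [RingHom.map_det]; exact h1
  rw [map_eq_zero_iff _ (IsFractionRing.injective Poly (FractionRing Poly)),
    Matrix.det_adjugate] at h2
  exact eq_zero_of_pow_eq_zero h2

end RealContact

theorem mainTheorem9 (d : ℕ) [NeZero d]
    (f : MvPolynomial (Fin 3) ℝ) (hf : f.IsHomogeneous d)
    (l : MvPolynomial (Fin 3) ℝ) (hl : l.IsHomogeneous 1) (hl0 : l ≠ 0)
    (hcard : (RealContact.zeroSet (RealContact.toComplex l) ∩
      RealContact.zeroSet (RealContact.toComplex f)).ncard = d)
    (hreal : ∀ P ∈ RealContact.zeroSet (RealContact.toComplex l) ∩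
      RealContact.zeroSet (RealContact.toComplex f), RealContact.conjPoint P = P)
    (D : RealContact.P2 →₀ ℤ) (hD : RealContact.IsRealContactDivisor f D)
    (hdeg : 2 * RealContact.divDeg D = (d : ℤ) * ((d : ℤ) - 1))
    (A : Matrix (Fin d) (Fin d) RealContact.Poly) (hA : RealContact.IsDixonMatrix f D A)
    (hdet : (RealContact.dixonRep f A).det = 0) :
    ∃ g ∈ RealContact.curveSystem A, RealContact.toComplex l ^ 2 ∣ g := by
  obtain ⟨c, hlc⟩ := RealContact.exists_eq_lineForm (l := RealContact.toComplex l) (hl.map _)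
  have hc : c ≠ 0 := by
    rintro rfl
    apply hl0
    refine MvPolynomial.map_injective _ Complex.ofRealHom.injective ?_
    change RealContact.toComplex l = _
    rw [hlc, map_zero]
    simp [RealContact.lineForm]
  have hcr : RealContact.conjPoly (RealContact.lineForm c) = RealContact.lineForm c := by
    rw [← hlc, RealContact.conjPoly_toComplex]
  rw [hlc] at hcard ⊢
  -- An infinite set has `ncard` 0, so d ≠ 0 gives finiteness.
  have hfin := Set.finite_of_ncard_ne_zero (hcard ▸ NeZero.ne d)
  have hmem : ∀ P ∈ hfin.toFinset, P ∈ RealContact.zeroSet (RealContact.lineForm c) ∧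
      P ∈ RealContact.zeroSet (RealContact.toComplex f) := fun P hP => hfin.mem_toFinset.1 hP
  obtain ⟨Q, hQ, hQZ⟩ := (RealContact.infinite_zeroSet_lineForm c).exists_notMem_finset
    hfin.toFinset
  have hQf : MvPolynomial.eval Q.rep (RealContact.toComplex f) ≠ 0 := fun h =>
    hQZ (hfin.mem_toFinset.2 ⟨hQ, h⟩)
  have hf0 : f ≠ 0 := by
    rintro rfl
    simp [RealContact.toComplex] at hQf
  have hA0 := RealContact.det_eq_zero_of_det_dixonRep hf0 hdet
  have hF : ¬ RealContact.lineForm c ∣ RealContact.toComplex f := fun h =>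
    hQf (RealContact.eval_eq_zero_of_dvd h hQ)
  obtain _ | _ | n := d
  · exact absurd rfl (NeZero.ne 0)
  -- For d = 1 the determinant is a₁₁, nonzero by independence of the first row.
  · rw [Matrix.det_fin_one A] at hA0
    exact absurd hA0 (hA.row_linearIndependent.ne_zero 0)
  · obtain ⟨v, hv0, hv⟩ := RealContact.exists_lineForm_sq_dvd_sesq (n := n) hA.homogeneous
      hA.hermitian hA.dvd_minor hc hcr hF
      ((Set.ncard_eq_toFinset_card _ hfin).symm.trans hcard) rfl
      (fun P hP => (hmem P hP).1) (fun P hP => (hmem P hP).2) hQ hQZ hA0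
    exact ⟨_, ⟨v, hv0, rfl⟩, hv⟩
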